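/- Let $G$ be a locally compact, $\sigma$-compact, Hausdorff abelian group, written additively, and let $C_c(G)$ and $C_b(G)$ be the spaces of complex continuous functions on $G$ that have compact support, respectively are bounded. A set $A\subset G$ is relatively dense if $\bigcup_{x\in A}(x+K)=G$ for some compact neighbourhood $K$ of the identity. It is uniformly discrete if there is an open neighbourhood $U$ of the identity such that $(x+U)\cap(y+U)=\emptyset$ for all distinct $x,y\in A$. It is a Delone set if it is both relatively dense and uniformly discrete. A function $f\in C_b(G)$ is Bohr almost periodic if for every $\varepsilon>0$ the set of all $t\in G$ with $\|f(\cdot-t)-f\|_\infty\le\varepsilon$ is relatively dense. Let $\mathcal M(G)$ be the space of complex Radon measures on $G$, identified with the linear functionals on $C_c(G)$ that, for each compact $K\subset G$, are bounded in the supremum norm on the functions supported in $K$. Let $\mathcal M^\infty(G)\subset\mathcal M(G)$ be the set of translation bounded measures, i.e. of those $\nu$ for which $\sup_{t\in G}|\nu|(t+V)<\infty$ for some nonempty open relatively compact $V\subset G$. Equip $\mathcal M^\infty(G)$ with the vague topology (the weakest one making all maps $\nu\mapsto\nu(\varphi)$, $\varphi\in C_c(G)$, continuous) and with the action $(\alpha_t\nu)(\varphi)=\nu(\varphi(\cdot+t))$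 of $G$. A measure $\nu\in\mathcal M^\infty(G)$ is strongly almost periodic if the function $(\nu*\varphi)(s)=\int\varphi(s-u)\,d\nu(u)$ is Bohr almost periodic for every $\varphi\in C_c(G)$. Let $\Lambda\subset G$ be a Delone set and let $\delta_\Lambda=\sum_{x\in\Lambda}\delta_x\in\mathcal M^\infty(G)$. The hull $X(\Lambda)$ is the closure of $\{\alpha_t\delta_\Lambda : t\in G\}$ in $\mathcal M^\infty(G)$ for the vague topology. It is invariant under the action $\alpha$. Write $t+\Lambda\in X(\Lambda)$ for $\alpha_t\delta_\Lambda=\delta_{t+\Lambda}$. Then the following assertions are equivalent: (i) For every $\varphi\in C_c(G)$ the function $f_{\Lambda,\varphi}(t)=\sum_{x\in\Lambda}\varphi(t-x)$ on $G$ is Bohr almost periodic. (ii) The measure $\delta_\Lambda$ is strongly almost periodic. (iii) There is an abelian group structure on $X(\Lambda)$ that, with the vague topology, makes $X(\Lambda)$ a compact (Hausdorff) topological group, has $\Lambda$ as its neutral element, and satisfies $(t+\Lambda)+(s+\Lambda)=(s+t)+\Lambda$ for all $s,t\in G$. (iv) The dynamical system $(X(\Lambda),G)$ is equicontinuous: for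 every entourage $V$ of the vague uniformity on $X(\Lambda)$ there is an entourage $U$ such that $(\alpha_t\omega,\alpha_t\omega')\in V$ for all $t\in G$ and all $(\omega,\omega')\in U$. -/

import Mathlib

open Filter Topology Set
open scoped Pointwise CompactlySupported ENNReal NNReal

noncomputable section

namespace DeloneDynamics

variable {G : Type*} [AddCommGroup G] [TopologicalSpace G]

/-! ### Delone sets -/

/-- `Λ` is uniformly discrete: for some open neighbourhood `U` of the identity, the translates
`x + U`, `x ∈ Λ`, are pairwise disjoint. -/
def UniformlyDiscrete (Λ : Set G) : Prop :=
  ∃ U : Set G, IsOpen U ∧ (0 : G) ∈ U ∧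
    ∀ x ∈ Λ, ∀ y ∈ Λ, x ≠ y → Disjoint (x +ᵥ U) (y +ᵥ U)

/-- `Λ` is relatively dense: for some compact neighbourhood `K` of the identity, the translates
`x + K`, `x ∈ Λ`, cover `G`. -/
def RelativelyDense (Λ : Set G) : Prop :=
  ∃ K : Set G, IsCompact K ∧ K ∈ 𝓝 (0 : G) ∧ ⋃ x ∈ Λ, (x +ᵥ K) = univ

/-- Delone sets: uniformly discrete and relatively dense subsets. -/
structure IsDelone (Λ : Set G) : Prop where
  uniformlyDiscrete : UniformlyDiscrete Λ
  relativelyDense : RelativelyDense Λ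

/-! ### Bohr almost periodic functions -/

/-- `f` is Bohr almost periodic: `f ∈ C_b(G)`, and for every `ε > 0` the set of `t` with
`‖f (· - t) - f‖_∞ ≤ ε` is relatively dense. -/
def BohrAlmostPeriodic (f : G → ℂ) : Prop :=
  Continuous f ∧ (∃ C : ℝ, ∀ s, ‖f s‖ ≤ C) ∧
    ∀ ε : ℝ, 0 < ε → RelativelyDense {t : G | ∀ s, ‖f (s - t) - f s‖ ≤ ε}

/-- The function `f_{Λ,φ}(t) = ∑_{x ∈ Λ} φ (t - x)`. For uniformly discrete `Λ` and compactly
supported `φ` each of these sums has only finitely many nonzero terms. -/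
def translateSum (Λ : Set G) (φ : C_c(G, ℂ)) (t : G) : ℂ :=
  ∑' x : Λ, φ (t - x)

/-! ### Complex Radon measures -/

/-- Complex (possibly unbounded) Radon measures on `G`, as the linear functionals on `C_c(G)` that
are continuous for the inductive limit topology, i.e. for every compact `K` they are bounded in the
supremum norm on the functions supported in `K`. The value at `φ` is `∫ φ dν`. -/
structure RadonMeasure (G : Type*) [TopologicalSpace G] extends C_c(G, ℂ) →ₗ[ℂ] ℂ where
  locally_bounded' : ∀ K : Set G, IsCompact K → ∃ C : ℝ, ∀ φ : C_c(G, ℂ), tsupport φ ⊆ K →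
    ∀ M : ℝ, (∀ x, ‖φ x‖ ≤ M) → ‖toFun φ‖ ≤ C * M

namespace RadonMeasure

instance {X : Type*} [TopologicalSpace X] : CoeFun (RadonMeasure X) (fun _ => C_c(X, ℂ) → ℂ) := ⟨fun ν => ν.toLinearMap⟩

theorem ext_apply {X : Type*} [TopologicalSpace X] {μ ν : RadonMeasure X} (h : ∀ φ, μ φ = ν φ) : μ = ν := by
  cases μ; cases ν
  congr
  exact LinearMap.ext h

/-- The vague uniformity: the coarsest one making all `ν ↦ ν φ`, `φ ∈ C_c(G)`, uniformly
continuous. -/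
instance : UniformSpace (RadonMeasure G) :=
  UniformSpace.comap (fun (ν : RadonMeasure G) (φ : C_c(G, ℂ)) => ν φ) inferInstance

/-- The value `|ν|(V)` of the total variation of `ν` on an open set `V`. -/
def variation (ν : RadonMeasure G) (V : Set G) : ℝ≥0∞ :=
  ⨆ (φ : C_c(G, ℂ)) (_ : tsupport φ ⊆ V) (_ : ∀ x, ‖φ x‖ ≤ 1), ‖ν φ‖ₑ

/-- `ν` is translation bounded: for some nonempty, open, relatively compact `V`, the values
`|ν|(t + V)`, `t ∈ G`, are bounded. -/
def TranslationBounded (ν : RadonMeasure G) : Prop :=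
  ∃ V : Set G, IsOpen V ∧ V.Nonempty ∧ IsCompact (closure V) ∧
    ∃ C : ℝ≥0, ∀ t : G, ν.variation (t +ᵥ V) ≤ C

end RadonMeasure

section Translation

variable [IsTopologicalAddGroup G]

/-- The function `u ↦ φ (u + t)`, that is, `δ_{-t} ∗ φ`. -/
def shift (t : G) (φ : C_c(G, ℂ)) : C_c(G, ℂ) where
  toFun u := φ (u + t)
  continuous_toFun := by fun_prop
  hasCompactSupport' := φ.hasCompactSupport.comp_homeomorph (Homeomorph.addRight t)

@[simp] theorem shift_apply (t : G) (φ : C_c(G, ℂ)) (u : G) : shift t φ u = φ (u + t) := rfl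

/-- The function `u ↦ φ (s - u)`. -/
def reflect (s : G) (φ : C_c(G, ℂ)) : C_c(G, ℂ) where
  toFun u := φ (s - u)
  continuous_toFun := by fun_prop
  hasCompactSupport' := φ.hasCompactSupport.comp_homeomorph (Homeomorph.subLeft s)

@[simp] theorem reflect_apply (s : G) (φ : C_c(G, ℂ)) (u : G) : reflect s φ u = φ (s - u) := rfl

theorem tsupport_shift (t : G) (φ : C_c(G, ℂ)) :
    tsupport (shift t φ) = (fun u => u + t) ⁻¹' tsupport φ :=
  tsupport_comp_eq_preimage φ (Homeomorph.addRight t)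

namespace RadonMeasure

/-- The translate `α_t ν`, `(α_t ν)(φ) = ν (δ_{-t} ∗ φ)`. -/
def translate (t : G) (ν : RadonMeasure G) : RadonMeasure G where
  toFun φ := ν (shift t φ)
  map_add' φ ψ := by
    have : shift t (φ + ψ) = shift t φ + shift t ψ := by ext; simp
    rw [this, map_add]
  map_smul' c φ := by
    have : shift t (c • φ) = c • shift t φ := by ext; simp
    rw [this, map_smul]; rfl
  locally_bounded' K hK := by
    obtain ⟨C, hC⟩ := ν.locally_bounded' ((fun u => u + t) ⁻¹' K)
      ((Homeomorph.addRight t).isCompact_preimage.2 hK)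
    refine ⟨C, fun φ hφ M hM => hC _ ?_ M fun x => hM _⟩
    rw [tsupport_shift]
    exact preimage_mono hφ

instance : VAdd G (RadonMeasure G) := ⟨translate⟩

theorem vadd_apply (t : G) (ν : RadonMeasure G) (φ : C_c(G, ℂ)) : (t +ᵥ ν) φ = ν (shift t φ) := rfl

/-- The action `α` of `G` on measures by translation. -/
instance : AddAction G (RadonMeasure G) where
  zero_vadd ν := ext_apply fun φ => by
    rw [vadd_apply]; congr 1; ext; simp
  add_vadd s t ν := ext_apply fun φ => by
    simp only [vadd_apply]; congr 1; ext u
    simp only [shift_apply]; congr 1; abel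

theorem TranslationBounded.vadd {ν : RadonMeasure G} (h : ν.TranslationBounded) (t : G) :
    (t +ᵥ ν).TranslationBounded := by
  obtain ⟨V, hV, hne, hc, C, hC⟩ := h
  refine ⟨V, hV, hne, hc, C, fun s => iSup_le fun φ => iSup_le fun hφ => iSup_le fun h1 => ?_⟩
  refine le_trans ?_ (hC (-t + s))
  rw [vadd_apply]
  refine le_iSup_of_le (shift t φ) (le_iSup_of_le ?_ (le_iSup_of_le (fun x => h1 _) le_rfl))
  rw [tsupport_shift]
  intro u hu
  have := hφ hu
  rw [mem_vadd_set_iff_neg_vadd_mem] at this ⊢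
  convert this using 1
  simp only [vadd_eq_add]; abel

/-- The convolution `(ν ∗ φ)(s) = ∫ φ (s - u) dν(u)`. -/
def conv (ν : RadonMeasure G) (φ : C_c(G, ℂ)) (s : G) : ℂ := ν (reflect s φ)

end RadonMeasure

/-! ### Translation bounded measures, strong almost periodicity and hulls -/

variable (G) in
/-- The space `M^∞(G)` of translation bounded measures, with the vague topology (as a subspace of
`M(G)`). -/
abbrev TBMeasure : Type _ := {ν : RadonMeasure G // ν.TranslationBounded}

namespace TBMeasure

instance : AddAction G (TBMeasure G) where
  vadd t ν := ⟨t +ᵥ ν.1, ν.2.vadd t⟩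
  zero_vadd ν := Subtype.ext (zero_vadd G ν.1)
  add_vadd s t ν := Subtype.ext (add_vadd s t ν.1)

theorem coe_vadd (t : G) (ν : TBMeasure G) : ((t +ᵥ ν : TBMeasure G) : RadonMeasure G) = t +ᵥ ν.1 :=
  rfl

/-- `ν` is strongly almost periodic if `ν ∗ φ` is Bohr almost periodic for all `φ ∈ C_c(G)`. -/
def StronglyAlmostPeriodic (ν : TBMeasure G) : Prop :=
  ∀ φ : C_c(G, ℂ), BohrAlmostPeriodic (ν.1.conv φ)

instance : ContinuousConstVAdd G (TBMeasure G) where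
  continuous_const_vadd t := by
    refine Continuous.subtype_mk ?_ _
    refine continuous_induced_rng.2 (continuous_pi fun φ => ?_)
    have h : Continuous fun (ν : RadonMeasure G) (φ : C_c(G, ℂ)) => ν φ := continuous_induced_dom
    exact ((continuous_apply (shift t φ)).comp h).comp continuous_subtype_val

/-- The hull `X(ν)`: the closure of the orbit `{α_t ν : t ∈ G}` in the vague topology. -/
def hull (ν : TBMeasure G) : Set (TBMeasure G) := closure (range fun t : G => t +ᵥ ν)

theorem self_mem_hull (ν : TBMeasure G) : ν ∈ hull ν :=
  subset_closure ⟨0, zero_vadd G ν⟩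

theorem vadd_mem_hull {ν μ : TBMeasure G} (hμ : μ ∈ hull ν) (t : G) : t +ᵥ μ ∈ hull ν := by
  refine map_mem_closure (continuous_const_vadd t) hμ ?_
  rintro _ ⟨s, rfl⟩
  exact ⟨t + s, add_vadd t s ν⟩

/-- The restriction of the translation action to the hull: the dynamical system `(X(ν), G)`. -/
instance (ν : TBMeasure G) : AddAction G (hull ν) where
  vadd t μ := ⟨t +ᵥ μ.1, vadd_mem_hull μ.2 t⟩
  zero_vadd μ := Subtype.ext (zero_vadd G μ.1)
  add_vadd s t μ := Subtype.ext (add_vadd s t μ.1)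

end TBMeasure

/-- The system `(X, G)` is equicontinuous: the family of all maps `x ↦ t +ᵥ x`, `t ∈ G`, is
(uniformly) equicontinuous for the uniformity of `X`. -/
def EquicontinuousSystem (G X : Type*) [AddCommGroup G] [UniformSpace X] [AddAction G X] : Prop :=
  UniformEquicontinuous fun (t : G) (x : X) => t +ᵥ x

/-! ### Dirac combs -/

theorem UniformlyDiscrete.exists_nhd {Λ : Set G} (hΛ : UniformlyDiscrete Λ) :
    ∃ V : Set G, IsOpen V ∧ (0 : G) ∈ V ∧ ∀ t : G, (Λ ∩ (t +ᵥ V)).Subsingleton := by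
  obtain ⟨U, hU, h0, hd⟩ := hΛ
  refine ⟨-U, hU.neg, by simpa using h0, ?_⟩
  rintro t x ⟨hx, hxV⟩ y ⟨hy, hyV⟩
  by_contra hxy
  rw [mem_vadd_set_iff_neg_vadd_mem] at hxV hyV
  have key : ∀ z : G, -t +ᵥ z ∈ -U → t ∈ z +ᵥ U := fun z hz => by
    rw [mem_vadd_set_iff_neg_vadd_mem]
    simpa [add_comm] using hz
  exact Set.disjoint_left.1 (hd x hx y hy hxy) (key x hxV) (key y hyV)

theorem UniformlyDiscrete.finite_inter {Λ : Set G} (hΛ : UniformlyDiscrete Λ) {K : Set G}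
    (hK : IsCompact K) : (Λ ∩ K).Finite := by
  obtain ⟨V, hV, h0, hs⟩ := hΛ.exists_nhd
  obtain ⟨F, hF⟩ := hK.elim_finite_subcover (fun t : G => t +ᵥ V) (fun t => hV.vadd t)
    fun x _ => mem_iUnion.2 ⟨x, by simpa [mem_vadd_set_iff_neg_vadd_mem] using h0⟩
  refine (F.finite_toSet.biUnion fun t _ => (hs t).finite).subset ?_
  rintro x ⟨hx, hxK⟩
  obtain ⟨t, ht, hxt⟩ := mem_iUnion₂.1 (hF hxK)
  exact mem_iUnion₂.2 ⟨t, ht, hx, hxt⟩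

theorem UniformlyDiscrete.tsum_eq {Λ : Set G} (hΛ : UniformlyDiscrete Λ) {K : Set G}
    (hK : IsCompact K) (φ : C_c(G, ℂ)) (hφ : tsupport φ ⊆ K) :
    ∑' x : Λ, φ x = ∑ x ∈ (hΛ.finite_inter hK).toFinset, φ x := by
  rw [tsum_subtype Λ φ, tsum_eq_sum (s := (hΛ.finite_inter hK).toFinset)]
  · refine Finset.sum_congr rfl fun x hx => ?_
    exact indicator_of_mem ((hΛ.finite_inter hK).mem_toFinset.1 hx).1 _
  · intro x hx
    by_cases hxΛ : x ∈ Λ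
    · rw [indicator_of_mem hxΛ]
      by_contra h
      exact hx ((hΛ.finite_inter hK).mem_toFinset.2 ⟨hxΛ, hφ (subset_tsupport _ h)⟩)
    · exact indicator_of_notMem hxΛ _

/-- The Dirac comb `δ_Λ = ∑_{x ∈ Λ} δ_x` of a uniformly discrete set, `δ_Λ(φ) = ∑_{x ∈ Λ} φ x`. -/
def combMeasure (Λ : Set G) (hΛ : UniformlyDiscrete Λ) : RadonMeasure G where
  toFun φ := ∑' x : Λ, φ x
  map_add' φ ψ := by
    have hK := φ.hasCompactSupport.isCompact.union ψ.hasCompactSupport.isCompact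
    rw [hΛ.tsum_eq hK (φ + ψ) (tsupport_add φ ψ), hΛ.tsum_eq hK φ subset_union_left,
      hΛ.tsum_eq hK ψ subset_union_right, ← Finset.sum_add_distrib]
    rfl
  map_smul' c φ := by
    simp [tsum_mul_left]
  locally_bounded' K hK := by
    refine ⟨(hΛ.finite_inter hK).toFinset.card, fun φ hφ M hM => ?_⟩
    rw [hΛ.tsum_eq hK φ hφ]
    refine (norm_sum_le_of_le _ fun x _ => hM x).trans ?_
    simp

theorem combMeasure_translationBounded [LocallyCompactSpace G] (Λ : Set G)
    (hΛ : UniformlyDiscrete Λ) : (combMeasure Λ hΛ).TranslationBounded := by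
  obtain ⟨V, hV, h0, hs⟩ := hΛ.exists_nhd
  obtain ⟨K, hK, hKV⟩ := exists_compact_mem_nhds (0 : G)
  refine ⟨V ∩ interior K, hV.inter isOpen_interior, ⟨0, h0, mem_interior_iff_mem_nhds.2 hKV⟩,
    hK.closure_of_subset (inter_subset_right.trans interior_subset), 1,
    fun t => iSup_le fun φ => iSup_le fun hφ => iSup_le fun h1 => ?_⟩
  have hsub : (Λ ∩ tsupport φ).Subsingleton := (hs t).anti
    (inter_subset_inter_right _ (hφ.trans (vadd_set_mono inter_subset_left)))
  have hK' := φ.hasCompactSupport.isCompact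
  change ‖∑' x : Λ, φ x‖ₑ ≤ _
  rw [hΛ.tsum_eq hK' φ subset_rfl]
  have hcard : (hΛ.finite_inter hK').toFinset.card ≤ 1 := by
    rw [Finset.card_le_one]
    intro a ha b hb
    exact hsub ((hΛ.finite_inter hK').mem_toFinset.1 ha) ((hΛ.finite_inter hK').mem_toFinset.1 hb)
  have hb : ‖∑ x ∈ (hΛ.finite_inter hK').toFinset, φ x‖ ≤ 1 := by
    refine (norm_sum_le_of_le _ fun x _ => h1 x).trans ?_
    simpa using hcard
  rw [← ofReal_norm]
  exact (ENNReal.ofReal_le_ofReal hb).trans (by simp)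

/-- The Dirac comb `δ_Λ` as an element of `M^∞(G)`. -/
def diracComb [LocallyCompactSpace G] (Λ : Set G) (hΛ : UniformlyDiscrete Λ) : TBMeasure G :=
  ⟨combMeasure Λ hΛ, combMeasure_translationBounded Λ hΛ⟩

/-- The hull `X(Λ) = X(δ_Λ)` of a uniformly discrete set. -/
abbrev setHull [LocallyCompactSpace G] (Λ : Set G) (hΛ : UniformlyDiscrete Λ) :
    Set (TBMeasure G) :=
  (diracComb Λ hΛ).hull

/-- The element of the hull `X(Λ)` given by `Λ` itself, i.e. by `δ_Λ`. -/
def basePoint [LocallyCompactSpace G] (Λ : Set G) (hΛ : UniformlyDiscrete Λ) : setHull Λ hΛ :=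
  ⟨diracComb Λ hΛ, TBMeasure.self_mem_hull _⟩

end Translation

end DeloneDynamics

end

/-!
The argument goes through equicontinuity of the hull `X` of `ν = δ_Λ`. The number of points of `Λ`
in a translate of a compact set is bounded (`exists_uniformBound_combMeasure`), so the functionals
in `X` satisfy common bounds, and `X` is compact (`compactSpace_hull`), as a closed subset of a
product of discs.

Up to the sign of the argument, `ν ∗ φ` is `t ↦ (α_t ν)(ψ)` for the reflection `ψ` of `φ`. If this
function is Bohr almost periodic for all `φ`, its translates are totally bounded in the supremum
norm, so that the maps `μ ↦ (α_s μ)(ψ)`, `s ∈ G`, form a totally bounded family of uniformly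
continuous functions on `X`; such a family is equicontinuous
(`equicontinuousSystem_of_stronglyAlmostPeriodic`). Conversely, the orbit of `ν` is covered by
finitely many small balls around points `α_a ν`, and if `α_t ν` lies in such a ball, then `t - a` is
an almost period, by equicontinuity (`stronglyAlmostPeriodic_of_equicontinuousSystem`).

The group structure belongs to a general fact about an action with a dense orbit. If the action is
equicontinuous, the acting group with the uniformity pulled back along the orbit map is a uniform
group, and a complete space `X` is its completion (`EquicontinuousSystem.exists_addCommGroup`).
Conversely, if `X` is a compact group, then `α_t` is the group translation by `α_t ν`, and such
translations are equicontinuous as addition is uniformly continuous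
(`EquicontinuousSystem.of_addCommGroup`).
-/

namespace DeloneDynamics

/-! ### Equicontinuous group actions -/

/-- A family of uniformly continuous maps that is totally bounded for uniform convergence is
uniformly equicontinuous. -/
theorem uniformEquicontinuous_of_finite_approx {ι X E : Type*} [UniformSpace X]
    [PseudoMetricSpace E] (F : ι → X → E) (hF : ∀ i, UniformContinuous (F i))
    (h : ∀ ε > 0, ∃ s : Set ι, s.Finite ∧ ∀ i, ∃ j ∈ s, ∀ x, dist (F i x) (F j x) ≤ ε) :
    UniformEquicontinuous F := by
  refine Metric.uniformity_basis_dist.uniformEquicontinuous_iff_right.2 fun ε hε => ?_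
  obtain ⟨s, hs, hsF⟩ := h (ε / 4) (by positivity)
  have hev : ∀ᶠ p in uniformity X, ∀ j ∈ s, dist (F j p.1) (F j p.2) < ε / 4 :=
    (eventually_all_finite hs).2 fun j _ => hF j (Metric.dist_mem_uniformity (by positivity))
  filter_upwards [hev] with p hp i
  obtain ⟨j, hj, hij⟩ := hsF i
  have h1 := hij p.1
  have h2 := hij p.2
  rw [dist_comm] at h2
  have h3 := hp j hj
  have h4 := dist_triangle4 (F i p.1) (F j p.1) (F j p.2) (F i p.2)
  change dist (F i p.1) (F i p.2) < ε
  linarith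

theorem uniformEquicontinuous_pi_iff {ι κ X E : Type*} [UniformSpace X] [UniformSpace E]
    {F : ι → X → κ → E} :
    UniformEquicontinuous F ↔ ∀ k, UniformEquicontinuous fun i x => F i x k := by
  rw [Pi.uniformSpace_eq, uniformEquicontinuous_iInf_rng]
  refine forall_congr' fun k => ?_
  let _ : UniformSpace (κ → E) := UniformSpace.comap (Function.eval k) inferInstance
  exact (IsUniformInducing.mk rfl : IsUniformInducing (Function.eval k : (κ → E) → E))
    |>.uniformEquicontinuous_iff

/-- An equicontinuous action on a complete Hausdorff uniform space with a dense orbit turns the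
space into a topological group: the pullback of the uniformity along the orbit map makes the acting
group a uniform group, and the space is its Hausdorff completion. -/
theorem EquicontinuousSystem.exists_addCommGroup {G X : Type*} [AddCommGroup G] [UniformSpace X]
    [CompleteSpace X] [T0Space X] [AddAction G X] (h : EquicontinuousSystem G X) (x₀ : X)
    (hd : DenseRange fun t : G => t +ᵥ x₀) :
    ∃ _ : AddCommGroup X, IsTopologicalAddGroup X ∧ 0 = x₀ ∧
      ∀ s t : G, (t +ᵥ x₀) + (s +ᵥ x₀) = (s + t) +ᵥ x₀ := by
  let _ : UniformSpace G := UniformSpace.comap (fun t => t +ᵥ x₀) inferInstance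
  have hind : IsUniformInducing fun t : G => t +ᵥ x₀ := ⟨rfl⟩
  have : IsUniformAddGroup G := by
    refine ⟨hind.uniformContinuous_iff.2 ?_⟩
    intro V hV
    obtain ⟨W, hW, hWV⟩ := comp_mem_uniformity_sets hV
    have hU := hind.uniformContinuous
      (Filter.inter_mem (h W hW) (symm_le_uniformity (h W hW)))
    rw [Filter.mem_map, uniformity_prod_eq_prod, Filter.mem_map]
    refine Filter.mem_of_superset (Filter.prod_mem_prod hU hU) ?_
    rintro ⟨⟨s, s'⟩, ⟨t, t'⟩⟩ ⟨h1, h2⟩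
    refine hWV ⟨(s' - t) +ᵥ x₀, ?_, ?_⟩
    -- the translation by `-t` moves the pair `s, s'` to `s - t, s' - t`
    · have : (-t +ᵥ (s +ᵥ x₀), -t +ᵥ (s' +ᵥ x₀)) ∈ W := h1.1 (-t)
      change ((s - t) +ᵥ x₀, (s' - t) +ᵥ x₀) ∈ W
      simpa only [vadd_vadd, neg_add_eq_sub] using this
    -- and the translation by `s' - t - t'` moves the pair `t', t` to `s' - t, s' - t'`
    · have : ((s' - t - t') +ᵥ (t' +ᵥ x₀), (s' - t - t') +ᵥ (t +ᵥ x₀)) ∈ W :=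
        h2.2 (s' - t - t')
      change ((s' - t) +ᵥ x₀, (s' - t') +ᵥ x₀) ∈ W
      have e1 : s' - t - t' + t' = s' - t := by abel
      have e2 : s' - t - t' + t = s' - t' := by abel
      simpa only [vadd_vadd, e1, e2] using this
  let pkg : AbstractCompletion G := ⟨X, fun t => t +ᵥ x₀, inferInstance, inferInstance,
    inferInstance, hind, hd⟩
  let e : X ≃ᵤ UniformSpace.Completion G := pkg.compareEquiv UniformSpace.Completion.cPkg
  have he : ∀ t : G, e (t +ᵥ x₀) = (t : UniformSpace.Completion G) := fun t =>
    AbstractCompletion.compare_coe pkg UniformSpace.Completion.cPkg t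
  let _ : AddCommGroup X := e.toEquiv.addCommGroup
  have hadd : ∀ x y : X, e (x + y) = e x + e y := fun x y => e.apply_symm_apply _
  have hzero : e 0 = 0 := e.apply_symm_apply _
  refine ⟨inferInstance, ?_, ?_, fun s t => ?_⟩
  · exact Topology.IsInducing.topologicalAddGroup
      (⟨⟨e, hzero⟩, hadd⟩ : X →+ UniformSpace.Completion G) e.toHomeomorph.isInducing
  · refine e.injective ?_
    rw [hzero, ← zero_vadd G x₀, he, UniformSpace.Completion.coe_zero]
  · refine e.injective ?_
    rw [hadd, he, he, he, add_comm s t, UniformSpace.Completion.coe_add]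

/-- If a compact Hausdorff group contains the image of `G` under `t ↦ t +ᵥ 0` as a dense subgroup,
then `t` acts on it as the group translation by `t +ᵥ 0`, and group translations of a compact group
are uniformly equicontinuous. -/
theorem EquicontinuousSystem.of_addCommGroup {G X : Type*} [AddCommGroup G] [UniformSpace X]
    [CompactSpace X] [T2Space X] [AddAction G X] [AddCommGroup X] [IsTopologicalAddGroup X]
    [ContinuousConstVAdd G X] (hd : DenseRange fun t : G => t +ᵥ (0 : X))
    (hadd : ∀ s t : G, (t +ᵥ (0 : X)) + (s +ᵥ (0 : X)) = (s + t) +ᵥ (0 : X)) :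
    EquicontinuousSystem G X := by
  have key : ∀ (t : G) (x : X), t +ᵥ x = (t +ᵥ (0 : X)) + x := fun t x =>
    congrFun (hd.equalizer (continuous_const_vadd t) (continuous_const.add continuous_id)
      (funext fun s => by simp [vadd_vadd, hadd, add_comm])) x
  have huc : UniformContinuous fun p : X × X => p.1 + p.2 :=
    CompactSpace.uniformContinuous_of_continuous continuous_add
  intro V hV
  have := huc hV
  rw [Filter.mem_map, uniformity_prod_eq_prod, Filter.mem_map] at this
  obtain ⟨A, hA, B, hB, hAB⟩ := Filter.mem_prod_iff.1 this
  filter_upwards [hB] with p hp t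
  rw [key t p.1, key t p.2]
  exact hAB (Set.mk_mem_prod (refl_mem_uniformity hA : (t +ᵥ (0 : X), t +ᵥ (0 : X)) ∈ A) hp)

/-! ### Compactness in the vague topology -/

section Vague

theorem RadonMeasure.isUniformInducing_eval {G : Type*} [TopologicalSpace G] :
    IsUniformInducing fun (ν : RadonMeasure G) (φ : C_c(G, ℂ)) => ν φ := ⟨rfl⟩

variable {G : Type*} [AddCommGroup G] [TopologicalSpace G]

theorem TBMeasure.isUniformEmbedding_eval :
    IsUniformEmbedding fun (ν : TBMeasure G) (φ : C_c(G, ℂ)) => ν.1 φ :=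
  ⟨RadonMeasure.isUniformInducing_eval.comp isUniformEmbedding_subtype_val.isUniformInducing,
    fun _ _ h => Subtype.ext (RadonMeasure.ext_apply fun φ => congrFun h φ)⟩

instance : T2Space (TBMeasure G) :=
  .of_injective_continuous TBMeasure.isUniformEmbedding_eval.injective
    TBMeasure.isUniformEmbedding_eval.uniformContinuous.continuous

theorem TBMeasure.uniformContinuous_eval (φ : C_c(G, ℂ)) :
    UniformContinuous fun ν : TBMeasure G => ν.1 φ :=
  (Pi.uniformContinuous_proj (fun _ : C_c(G, ℂ) => ℂ) φ).comp
    TBMeasure.isUniformEmbedding_eval.uniformContinuous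

theorem exists_norm_le {G : Type*} [TopologicalSpace G] (φ : C_c(G, ℂ)) : ∃ M : ℝ, ∀ x, ‖φ x‖ ≤ M :=
  φ.hasCompactSupport.exists_bound_of_continuous φ.continuous

/-- `UniformBound F C` says that, for each compact `K`, the functional `F` is bounded by `C K` on
the unit balls of all the spaces of functions supported in a translate of `K`. -/
def UniformBound (F : C_c(G, ℂ) → ℂ) (C : Set G → ℝ) : Prop :=
  ∀ K : Set G, IsCompact K → ∀ t : G, ∀ φ : C_c(G, ℂ), tsupport φ ⊆ t +ᵥ K →
    ∀ M : ℝ, (∀ x, ‖φ x‖ ≤ M) → ‖F φ‖ ≤ C K * M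

theorem isClosed_setOf_uniformBound (C : Set G → ℝ) :
    IsClosed {F : C_c(G, ℂ) → ℂ | UniformBound F C} := by
  simp only [UniformBound, Set.ofPred_forall]
  refine isClosed_iInter fun K => isClosed_iInter fun _ => isClosed_iInter fun _ =>
    isClosed_iInter fun φ => isClosed_iInter fun _ => isClosed_iInter fun M =>
    isClosed_iInter fun _ => ?_
  exact isClosed_le (continuous_apply φ).norm continuous_const

/-- Vague compactness of the set of measures with given bounds: in the product `C_c(G) → ℂ` it is
the closed set of linear functionals with these bounds, which lies in a product of discs. -/
theorem isCompact_setOf_uniformBound [T2Space G] [LocallyCompactSpace G] (C : Set G → ℝ) :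
    IsCompact {ν : TBMeasure G | UniformBound ν.1 C} := by
  rw [TBMeasure.isUniformEmbedding_eval.isUniformInducing.isInducing.isCompact_iff]
  have himage : (fun (ν : TBMeasure G) (φ : C_c(G, ℂ)) => ν.1 φ) ''
      {ν : TBMeasure G | UniformBound ν.1 C} =
      {F | UniformBound F C} ∩ ((⋂ (φ) (ψ), {F | F (φ + ψ) = F φ + F ψ}) ∩
        ⋂ (c : ℂ) (φ), {F | F (c • φ) = c * F φ}) := by
    ext F
    constructor
    · rintro ⟨ν, hν, rfl⟩
      refine ⟨hν, mem_iInter₂.2 fun φ ψ => ν.1.map_add φ ψ,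
        mem_iInter₂.2 fun c φ => ν.1.map_smul c φ⟩
    · rintro ⟨hF, h1, h2⟩
      let μ : RadonMeasure G :=
        { toFun := F
          map_add' := fun φ ψ => mem_iInter₂.1 h1 φ ψ
          map_smul' := fun c φ => mem_iInter₂.1 h2 c φ
          locally_bounded' := fun K hK => ⟨C K, fun φ hφ => hF K hK 0 φ (by rwa [zero_vadd])⟩ }
      obtain ⟨K, hK, hK0⟩ := exists_compact_mem_nhds (0 : G)
      refine ⟨⟨μ, interior K, isOpen_interior, ⟨0, mem_interior_iff_mem_nhds.2 hK0⟩,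
        hK.closure_of_subset interior_subset, (C K).toNNReal, fun t => iSup_le fun φ =>
          iSup_le fun hφ => iSup_le fun hφ1 => ?_⟩, hF, rfl⟩
      have := hF K hK t φ (hφ.trans (vadd_set_mono interior_subset)) 1 hφ1
      rw [mul_one] at this
      rw [← ofReal_norm]
      exact ENNReal.ofReal_le_ofReal this
  rw [himage]
  choose M hM using exists_norm_le (G := G)
  refine (isCompact_univ_pi fun φ : C_c(G, ℂ) =>
    isCompact_closedBall (0 : ℂ) (C (tsupport φ) * M φ)).of_isClosed_subset ?_ ?_
  · refine (isClosed_setOf_uniformBound C).inter (.inter ?_ ?_)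
    · exact isClosed_iInter fun φ => isClosed_iInter fun ψ =>
        isClosed_eq (continuous_apply (φ + ψ)) ((continuous_apply φ).add (continuous_apply ψ))
    · exact isClosed_iInter fun c => isClosed_iInter fun φ =>
        isClosed_eq (continuous_apply (c • φ)) (continuous_const.mul (continuous_apply φ))
  · rintro F ⟨hF, -⟩ φ -
    rw [mem_closedBall_zero_iff]
    exact hF _ φ.hasCompactSupport 0 φ (by rw [zero_vadd]) _ (hM φ)

end Vague

section Hull

variable {G : Type*} [AddCommGroup G] [TopologicalSpace G] [IsTopologicalAddGroup G]

theorem UniformBound.vadd {ν : RadonMeasure G} {C : Set G → ℝ} (h : UniformBound ν C) (s : G) :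
    UniformBound (s +ᵥ ν : RadonMeasure G) C := by
  intro K hK t φ hφ M hM
  refine h K hK (-s + t) (shift s φ) ?_ M fun x => hM _
  rw [tsupport_shift]
  intro u hu
  have := hφ hu
  rw [mem_vadd_set_iff_neg_vadd_mem] at this ⊢
  convert this using 1
  simp only [vadd_eq_add]; abel

theorem compactSpace_hull [T2Space G] [LocallyCompactSpace G] {ν : TBMeasure G} {C : Set G → ℝ}
    (h : UniformBound ν.1 C) : CompactSpace ν.hull := by
  rw [← isCompact_iff_compactSpace]
  have hc := isCompact_setOf_uniformBound (G := G) C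
  refine hc.of_isClosed_subset isClosed_closure (closure_minimal ?_ hc.isClosed)
  rintro _ ⟨t, rfl⟩
  exact h.vadd t

/-- The Dirac comb of a uniformly discrete set `Λ` is uniformly bounded, because the number of
points of `Λ` in a translate of a compact set `K` is at most the number of translates of a small
neighbourhood of `0` that are needed to cover `K`. -/
theorem exists_uniformBound_combMeasure {Λ : Set G} (hΛ : UniformlyDiscrete Λ) :
    ∃ C : Set G → ℝ, UniformBound (combMeasure Λ hΛ) C := by
  obtain ⟨V, hV, h0, hs⟩ := hΛ.exists_nhd
  have hcover : ∀ K : Set G, ∃ F : Finset G, IsCompact K → K ⊆ ⋃ t ∈ F, t +ᵥ V := by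
    intro K
    by_cases hK : IsCompact K
    · obtain ⟨F, hF⟩ := hK.elim_finite_subcover (fun t : G => t +ᵥ V) (fun t => hV.vadd t)
        fun x _ => mem_iUnion.2 ⟨x, by simpa [mem_vadd_set_iff_neg_vadd_mem] using h0⟩
      exact ⟨F, fun _ => hF⟩
    · exact ⟨∅, fun h => absurd h hK⟩
  choose F hF using hcover
  refine ⟨fun K => (F K).card, fun K hK t φ hφ M hM => ?_⟩
  have hM0 : 0 ≤ M := (norm_nonneg _).trans (hM 0)
  have hKt : IsCompact (t +ᵥ K) := hK.vadd t
  change ‖∑' x : Λ, φ x‖ ≤ _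
  rw [hΛ.tsum_eq hKt φ hφ]
  refine (norm_sum_le_of_le _ fun x _ => hM x).trans ?_
  rw [Finset.sum_const, nsmul_eq_mul]
  refine mul_le_mul_of_nonneg_right (Nat.cast_le.2 ?_) hM0
  -- two points of `Λ ∩ (t + K)` lying in the same translate of `V` coincide
  have hex : ∀ x ∈ Λ ∩ (t +ᵥ K), ∃ a ∈ F K, x ∈ (t + a) +ᵥ V := by
    rintro x ⟨-, hx⟩
    rw [mem_vadd_set_iff_neg_vadd_mem] at hx
    obtain ⟨a, ha, hxa⟩ := mem_iUnion₂.1 (hF K hK hx)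
    refine ⟨a, ha, ?_⟩
    rwa [← vadd_vadd, mem_vadd_set_iff_neg_vadd_mem]
  choose! a ha hxa using hex
  refine Finset.card_le_card_of_injOn a (fun x hx => ha x ?_) fun x hx y hy hxy => ?_
  · exact (Set.Finite.mem_toFinset _).1 hx
  · have hx' := (Set.Finite.mem_toFinset _).1 hx
    have hy' := (Set.Finite.mem_toFinset _).1 hy
    exact hs _ ⟨hx'.1, hxa x hx'⟩ ⟨hy'.1, hxy ▸ hxa y hy'⟩

instance (ν : TBMeasure G) : ContinuousConstVAdd G ν.hull where
  continuous_const_vadd t :=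
    ((continuous_const_vadd t).comp continuous_subtype_val).subtype_mk _

theorem denseRange_vadd_hull (ν : TBMeasure G) :
    DenseRange fun t : G => t +ᵥ (⟨ν, ν.self_mem_hull⟩ : ν.hull) := by
  rw [DenseRange, Subtype.dense_iff]
  refine subset_of_eq (congrArg closure ?_)
  rw [← range_comp]
  rfl

theorem equicontinuousSystem_hull_iff (ν : TBMeasure G) :
    EquicontinuousSystem G ν.hull ↔ ∀ φ : C_c(G, ℂ),
      UniformEquicontinuous fun (t : G) (μ : ν.hull) => μ.1.1 (shift t φ) := by
  have hemb := TBMeasure.isUniformEmbedding_eval.isUniformInducing.comp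
    (isUniformEmbedding_subtype_val (p := (· ∈ ν.hull))).isUniformInducing
  rw [EquicontinuousSystem, hemb.uniformEquicontinuous_iff, uniformEquicontinuous_pi_iff]
  rfl

/-! ### Almost periodicity and equicontinuity -/

/-- The convolution with a uniformly bounded measure is uniformly continuous, here written for the
reflected function `t ↦ ν (φ (· + t))`. -/
theorem UniformBound.eventually_norm_shift_sub_le [T2Space G] [LocallyCompactSpace G]
    {ν : RadonMeasure G}
    {C : Set G → ℝ} (h : UniformBound ν C) (φ : C_c(G, ℂ)) {ε : ℝ} (hε : 0 < ε) (k₀ : G) :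
    ∀ᶠ k in 𝓝 k₀, ∀ t : G, ‖ν (shift (k + t) φ) - ν (shift (k₀ + t) φ)‖ ≤ ε := by
  obtain ⟨L, hL, hLk⟩ := exists_compact_mem_nhds k₀
  have hK : IsCompact (tsupport φ - L) := by
    rw [sub_eq_add_neg]; exact φ.hasCompactSupport.isCompact.add hL.neg
  set K := tsupport φ - L
  -- for `k ∈ L`, the function `φ (· + k)` is supported in `K`
  have hsupp : ∀ k ∈ L, ∀ x, x ∉ K → φ (x + k) = 0 := by
    intro k hk x hx
    by_contra hne
    exact hx ⟨x + k, subset_tsupport _ hne, k, hk, add_sub_cancel_right x k⟩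
  set δ := ε / (|C K| + 1)
  have hδ : 0 < δ := by positivity
  have htube : ∀ᶠ k in 𝓝 k₀, ∀ x ∈ K, ‖φ (x + k) - φ (x + k₀)‖ ≤ δ := by
    refine hK.eventually_forall_of_forall_eventually fun x _ => ?_
    have hcont : Continuous fun p : G × G => ‖φ (p.2 + p.1) - φ (p.2 + k₀)‖ := by fun_prop
    refine (hcont.tendsto (k₀, x)).eventually (ge_mem_nhds ?_)
    simpa using hδ
  filter_upwards [htube, hLk] with k hk hkL t
  have hψ : ∀ x, ‖(shift k φ - shift k₀ φ) x‖ ≤ δ := by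
    intro x
    by_cases hx : x ∈ K
    · exact hk x hx
    · simp [hsupp k hkL x hx, hsupp k₀ (mem_of_mem_nhds hLk) x hx, hδ.le]
  have hψK : tsupport (shift k φ - shift k₀ φ) ⊆ (0 : G) +ᵥ K := by
    rw [zero_vadd]
    refine closure_minimal (fun x hx => ?_) hK.isClosed
    by_contra hxK
    exact hx (by simp [hsupp k hkL x hxK, hsupp k₀ (mem_of_mem_nhds hLk) x hxK])
  have hb := h.vadd t K hK 0 _ hψK δ hψ
  have heq : (t +ᵥ ν : RadonMeasure G) (shift k φ - shift k₀ φ) =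
      ν (shift (k + t) φ) - ν (shift (k₀ + t) φ) := by
    rw [map_sub, RadonMeasure.vadd_apply, RadonMeasure.vadd_apply]
    congr 2 <;> (ext u; simp only [shift_apply]; congr 1; abel)
  rw [heq] at hb
  refine hb.trans ?_
  have h1 : |C K| * δ ≤ ε := by
    have : (|C K| + 1) * δ = ε := by simp only [δ]; field_simp
    nlinarith
  exact (mul_le_mul_of_nonneg_right (le_abs_self _) hδ.le).trans h1

theorem RadonMeasure.conv_eq_shift (ν : RadonMeasure G) (φ : C_c(G, ℂ)) (s : G) :
    ν.conv φ s = ν (shift (-s) (reflect 0 φ)) := by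
  rw [RadonMeasure.conv]
  congr 1
  ext u
  simp only [reflect_apply, shift_apply]
  congr 1
  abel

theorem RadonMeasure.apply_shift_eq_conv (ν : RadonMeasure G) (φ : C_c(G, ℂ)) (t : G) :
    ν (shift t φ) = ν.conv (reflect 0 φ) (-t) := by
  rw [RadonMeasure.conv]
  congr 1
  ext u
  simp only [reflect_apply, shift_apply]
  congr 1
  abel

/-- Every translate of a Bohr almost periodic function `f` differs little from a translate by an
element of a fixed compact set, and by uniform continuity finitely many such translates suffice.
Hence the maps `μ ↦ (α_s μ)(φ)` form a totally bounded family on the orbit, and on its closure. -/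
theorem equicontinuousSystem_of_stronglyAlmostPeriodic [T2Space G] [LocallyCompactSpace G]
    {ν : TBMeasure G}
    {C : Set G → ℝ} (hC : UniformBound ν.1 C) (h : ν.StronglyAlmostPeriodic) :
    EquicontinuousSystem G ν.hull := by
  refine (equicontinuousSystem_hull_iff ν).2 fun φ => ?_
  have hcont : ∀ t : G, UniformContinuous fun μ : ν.hull => μ.1.1 (shift t φ) := fun t =>
    (TBMeasure.uniformContinuous_eval _).comp uniformContinuous_subtype_val
  refine uniformEquicontinuous_of_finite_approx _ hcont fun ε hε => ?_
  obtain ⟨K, hK, -, hcov⟩ := (h (reflect 0 φ)).2.2 (ε / 2) (by positivity)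
  have hev := fun k : G => hC.eventually_norm_shift_sub_le φ (half_pos hε) k
  obtain ⟨s, -, hs⟩ := hK.elim_nhds_subcover _ fun k _ => hev k
  refine ⟨s, s.finite_toSet, fun i => ?_⟩
  have hi : i ∈ ⋃ x ∈ _, (x +ᵥ K) := hcov.symm ▸ mem_univ i
  obtain ⟨a, ha, k, hk, hak⟩ := mem_iUnion₂.1 hi
  obtain ⟨j, hj, hkj⟩ := mem_iUnion₂.1 (hs hk)
  have hak : a + k = i := hak
  refine ⟨j, hj, fun μ => ?_⟩
  refine (denseRange_vadd_hull ν).induction_on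
    (p := fun μ : ν.hull => dist (μ.1.1 (shift i φ)) (μ.1.1 (shift j φ)) ≤ ε) μ
    (isClosed_le ((hcont i).continuous.dist (hcont j).continuous) continuous_const) fun t => ?_
  have h1 : ∀ l : G, (t +ᵥ ν.1) (shift l φ) = ν.1 (shift (l + t) φ) := by
    intro l
    rw [RadonMeasure.vadd_apply]
    congr 1
    ext u
    simp only [shift_apply]
    congr 1
    abel
  change dist ((t +ᵥ ν.1) (shift i φ)) ((t +ᵥ ν.1) (shift j φ)) ≤ ε
  rw [h1, h1]
  have h2 : ‖ν.1 (shift (i + t) φ) - ν.1 (shift (k + t) φ)‖ ≤ ε / 2 := by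
    have := ha (-(k + t))
    have e : -(k + t) - a = -(i + t) := by rw [← hak]; abel
    rwa [e, ← RadonMeasure.apply_shift_eq_conv, ← RadonMeasure.apply_shift_eq_conv] at this
  have h3 : ‖ν.1 (shift (k + t) φ) - ν.1 (shift (j + t) φ)‖ ≤ ε / 2 := hkj t
  rw [dist_eq_norm]
  refine (norm_sub_le_norm_sub_add_norm_sub _ (ν.1 (shift (k + t) φ)) _).trans ?_
  linarith

/-- The orbit is totally bounded, so each of its points `α_t ν` is close to one of finitely many
`α_a ν`; by equicontinuity `α_{t - a} ν` is then close to `ν`, uniformly along the action, so that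
`t - a` is an almost period. -/
theorem stronglyAlmostPeriodic_of_equicontinuousSystem [T2Space G] [LocallyCompactSpace G]
    {ν : TBMeasure G}
    {C : Set G → ℝ} (hC : UniformBound ν.1 C) (h : EquicontinuousSystem G ν.hull) :
    ν.StronglyAlmostPeriodic := by
  intro φ
  refine ⟨?_, ?_, fun ε hε => ?_⟩
  · refine continuous_iff_continuousAt.2 fun s => Metric.tendsto_nhds.2 fun ε hε => ?_
    have hneg : Tendsto (fun s : G => -s) (𝓝 s) (𝓝 (-s)) := continuous_neg.tendsto s
    filter_upwards [hneg.eventually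
      (hC.eventually_norm_shift_sub_le (reflect 0 φ) (half_pos hε) (-s))] with r hr
    have := hr 0
    rw [add_zero, add_zero, ← RadonMeasure.conv_eq_shift, ← RadonMeasure.conv_eq_shift] at this
    rw [dist_eq_norm]
    linarith
  · obtain ⟨M, hM⟩ := exists_norm_le φ
    refine ⟨C (tsupport (reflect 0 φ)) * M, fun s => ?_⟩
    rw [RadonMeasure.conv_eq_shift]
    exact hC.vadd (-s) _ (reflect 0 φ).hasCompactSupport 0 (reflect 0 φ) (by rw [zero_vadd]) M
      fun x => hM _
  · have := compactSpace_hull hC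
    set x₀ : ν.hull := ⟨ν, ν.self_mem_hull⟩
    -- pairs of points that are `φ`-close along the whole action form an entourage `U`, and so do
    -- the pairs whose translates are all in `U`
    have hU := (equicontinuousSystem_hull_iff ν).1 h (reflect 0 φ) _ (Metric.dist_mem_uniformity hε)
    have hU' := h _ hU
    obtain ⟨T, hT, hTfin, hTcov⟩ := TotallyBounded.exists_subset
      (isCompact_univ.totallyBounded.subset (subset_univ (range fun t : G => t +ᵥ x₀))) hU'
    choose! a ha using fun y (hy : y ∈ T) => hT hy
    obtain ⟨K, hK, hK0⟩ := exists_compact_mem_nhds (0 : G)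
    refine ⟨K ∪ a '' T, hK.union (hTfin.image a).isCompact,
      mem_of_superset hK0 subset_union_left, eq_univ_of_forall fun t => ?_⟩
    obtain ⟨y, hy, hty⟩ := mem_iUnion₂.1 (hTcov ⟨t, rfl⟩)
    refine mem_iUnion₂.2 ⟨t - a y, fun s => ?_, a y, Or.inr ⟨y, hy, rfl⟩, sub_add_cancel t (a y)⟩
    rw [← ha y hy] at hty
    have hclose := hty (-a y) (-s)
    have e : ∀ r : G, (-a y +ᵥ (r +ᵥ x₀)).1.1 (shift (-s) (reflect 0 φ)) =
        ν.1.conv φ (s - (r - a y)) := by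
      intro r
      rw [RadonMeasure.conv_eq_shift]
      change ν.1 (shift r (shift (-a y) (shift (-s) (reflect 0 φ)))) = _
      congr 1
      ext u
      simp only [shift_apply]
      congr 1
      abel
    have hclose' : dist (ν.1.conv φ (s - (t - a y))) (ν.1.conv φ (s - (a y - a y))) < ε := by
      rw [← e, ← e]
      exact hclose
    rw [sub_self, sub_zero, dist_eq_norm] at hclose'
    exact hclose'.le

end Hull

end DeloneDynamics

open DeloneDynamics in
theorem mainTheorem4 {G : Type*} [AddCommGroup G] [TopologicalSpace G] [IsTopologicalAddGroup G]
    [T2Space G] [LocallyCompactSpace G] [SigmaCompactSpace G]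
    (Λ : Set G) (hΛ : IsDelone Λ) :
    List.TFAE
      [∀ φ : C_c(G, ℂ), BohrAlmostPeriodic (translateSum Λ φ),
        (diracComb Λ hΛ.uniformlyDiscrete).StronglyAlmostPeriodic,
        CompactSpace (setHull Λ hΛ.uniformlyDiscrete) ∧
          T2Space (setHull Λ hΛ.uniformlyDiscrete) ∧
          ∃ _ : AddCommGroup (setHull Λ hΛ.uniformlyDiscrete),
            IsTopologicalAddGroup (setHull Λ hΛ.uniformlyDiscrete) ∧
            0 = basePoint Λ hΛ.uniformlyDiscrete ∧
            ∀ s t : G,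
              (t +ᵥ basePoint Λ hΛ.uniformlyDiscrete) + (s +ᵥ basePoint Λ hΛ.uniformlyDiscrete) =
                (s + t) +ᵥ basePoint Λ hΛ.uniformlyDiscrete,
        EquicontinuousSystem G (setHull Λ hΛ.uniformlyDiscrete)] := by
  obtain ⟨C, hC⟩ := exists_uniformBound_combMeasure hΛ.uniformlyDiscrete
  have hd := denseRange_vadd_hull (diracComb Λ hΛ.uniformlyDiscrete)
  have hcompact : CompactSpace (setHull Λ hΛ.uniformlyDiscrete) :=
    compactSpace_hull (ν := diracComb Λ hΛ.uniformlyDiscrete) hC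
  -- `f_{Λ,φ}` is by definition the convolution of `δ_Λ` and `φ`
  tfae_have 1 ↔ 2 := Iff.rfl
  tfae_have 2 → 4 := fun h => equicontinuousSystem_of_stronglyAlmostPeriodic
    (ν := diracComb Λ hΛ.uniformlyDiscrete) hC h
  tfae_have 4 → 2 := fun h => stronglyAlmostPeriodic_of_equicontinuousSystem
    (ν := diracComb Λ hΛ.uniformlyDiscrete) hC h
  tfae_have 4 → 3 := fun h =>
    ⟨hcompact, inferInstance, h.exists_addCommGroup (basePoint Λ hΛ.uniformlyDiscrete) hd⟩
  tfae_have 3 → 4 := by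
    rintro ⟨-, -, _, _, h0, hadd⟩
    rw [← h0] at hadd
    refine EquicontinuousSystem.of_addCommGroup ?_ hadd
    rw [h0]
    exact hd
  tfae_finish
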